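/- Let $\mathsf R$ be a (coloured, symmetric) operad in the category of sets, with set of colours $I$; every operation $b$ has an arity $n$, input colours $(i_1,\dots,i_n)$ and an output colour. Write: - $\mathbb B$ for the groupoid of finite sets $\{1,\dots,n\}$ and bijections; $\mathsf S X$, for a groupoid $X$, for the groupoid of finite families $(x_j)_{1\le j\le n}$ of objects of $X$, an arrow $(x_j)_{j\le n}\to(y_j)_{j\le m}$ being a bijection $\sigma:\{1,\dots,n\}\to\{1,\dots,m\}$ together with arrows $x_j\to y_{\sigma(j)}$; - $B$ for the groupoid of operations of $\mathsf R$, the disjoint union of the action groupoids of the symmetric groups acting on the sets of $n$-ary operations (an arrow $b\to b'$ is a permutation $\sigma$ with $b=b'\sigma$); taking output colours gives $t:B\to I$, and taking the sequence of input colours gives $B\to\mathsf S I$; - $C_2$ for the groupoid of operations labelled by operations: its objects are operations $b$ together with operations $b_1,\dots,b_n$ ($n$ the arity of $b$) such that the output colour of $b_j$ is the $j$-th input colour of $b$, and its arrows are arrows $\sigma:b\to b'$ in $B$ together with arrows $b_j\to b'_{\sigma(j)}$ in $B$. It maps to $\mathsf S B\times B$ by $(b;b_1,\dots,b_n)\mapsto((b_1,\dots,b_n),b)$;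 - for $w\in\mathsf S I$, $B^w$ for the homotopy fibre over $w$ of $\mathsf S t:\mathsf S B\to\mathsf S I$, and ${}_wB$ for the homotopy fibre over $w$ of the input colour map $B\to\mathsf S I$; - $\int^{s\in S}X_s=\sum_{s\in\pi_0 S}X_s/\!\operatorname{Aut}(s)$ for the homotopy sum of a family of groupoids $X_s$ indexed by a groupoid $S$: the disjoint union, over one object $s$ chosen in each isomorphism class, of the action groupoids $X_s/\!\operatorname{Aut}(s)$. Then there is an equivalence of groupoids $$C_2\;\simeq\;\int^{w\in\mathsf S I}B^w\times{}_wB$$ over $\mathsf S B\times B$, i.e. commuting with the canonical maps to $\mathsf S B\times B$ up to natural isomorphism. If moreover $I$ is a one-element set, then $$C_2\;\simeq\;\int^{n\in\mathbb B}B^n\times{}_nB$$ over $\mathsf S B\times B$, where $B^n$ is the groupoid of $n$-tuples of operations, on which bijections act by permuting the entries, and ${}_nB$ is the homotopy fibre over $n$ of the arity map $B\to\mathbb B$. -/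

import Mathlib

open CategoryTheory

universe u v v₁ v₂ v₃ u₁ u₂ u₃

noncomputable section

/-! ### Coloured symmetric operads in sets -/

/-- A (coloured, symmetric) operad in the category of sets with set of colours `I`, in the
classical presentation: sets of `n`-ary operations with input and output colours, right actions
of the symmetric groups, units and substitution.  The action is written for bijections
`Fin m ≃ Fin n`; such a bijection exists only for `m = n`, so that this is exactly an action of
each symmetric group.  Composites are indexed by `Fin (∑ j, k j)`, which is identified with
`Σ j, Fin (k j)` by the lexicographic order (`finSigmaFinEquiv`). -/
structure SymmetricOperad (I : Type u) where
  /-- the set of `n`-ary operations -/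
  Op : ℕ → Type v
  /-- the input colours of an operation -/
  inp : ∀ {n : ℕ}, Op n → Fin n → I
  /-- the output colour of an operation -/
  out : ∀ {n : ℕ}, Op n → I
  /-- the right action of the symmetric groups, `b ↦ b.σ` -/
  act : ∀ {m n : ℕ}, Op n → (Fin m ≃ Fin n) → Op m
  inp_act : ∀ {m n : ℕ} (b : Op n) (σ : Fin m ≃ Fin n) (j : Fin m), inp (act b σ) j = inp b (σ j)
  out_act : ∀ {m n : ℕ} (b : Op n) (σ : Fin m ≃ Fin n), out (act b σ) = out b
  act_refl : ∀ {n : ℕ} (b : Op n), act b (Equiv.refl (Fin n)) = b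
  act_act : ∀ {l m n : ℕ} (b : Op n) (σ : Fin m ≃ Fin n) (τ : Fin l ≃ Fin m),
    act (act b σ) τ = act b (τ.trans σ)
  /-- the unit operation of each colour -/
  one : I → Op 1
  inp_one : ∀ (c : I) (j : Fin 1), inp (one c) j = c
  out_one : ∀ c : I, out (one c) = c
  /-- substitution `b ∘ (a₁, …, aₙ)`, defined when the output colours of the `aⱼ` are the input
  colours of `b` -/
  comp : ∀ {n : ℕ} (b : Op n) {k : Fin n → ℕ} (a : ∀ j, Op (k j)),
    (∀ j, out (a j) = inp b j) → Op (∑ j, k j)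
  inp_comp : ∀ {n : ℕ} (b : Op n) {k : Fin n → ℕ} (a : ∀ j, Op (k j))
    (h : ∀ j, out (a j) = inp b j) (p : Fin (∑ j, k j)),
    inp (comp b a h) p = inp (a (finSigmaFinEquiv.symm p).1) (finSigmaFinEquiv.symm p).2
  out_comp : ∀ {n : ℕ} (b : Op n) {k : Fin n → ℕ} (a : ∀ j, Op (k j))
    (h : ∀ j, out (a j) = inp b j), out (comp b a h) = out b
  /-- left unit law -/
  one_comp : ∀ {n : ℕ} (b : Op n) (c : I) (h : ∀ j : Fin 1, out b = inp (one c) j),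
    comp (one c) (k := fun _ => n) (fun _ => b) h =
      act b (finSigmaFinEquiv.symm.trans (Equiv.uniqueSigma fun _ : Fin 1 => Fin n))
  /-- right unit law -/
  comp_one : ∀ {n : ℕ} (b : Op n),
    comp b (k := fun _ => 1) (fun j => one (inp b j)) (fun j => out_one (inp b j)) =
      act b (finSigmaFinEquiv.symm.trans (Equiv.sigmaUnique (Fin n) fun _ => Fin 1))
  /-- associativity -/
  comp_assoc : ∀ {n : ℕ} (b : Op n) {k : Fin n → ℕ} (a : ∀ j, Op (k j))
    {l : ∀ j, Fin (k j) → ℕ} (d : ∀ j i, Op (l j i))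
    (hab : ∀ j, out (a j) = inp b j) (hda : ∀ j i, out (d j i) = inp (a j) i)
    (h₁ : ∀ p : Fin (∑ j, k j),
      out (d (finSigmaFinEquiv.symm p).1 (finSigmaFinEquiv.symm p).2) = inp (comp b a hab) p)
    (h₂ : ∀ j, out (comp (a j) (d j) (hda j)) = inp b j),
    comp (comp b a hab)
        (k := fun p => l (finSigmaFinEquiv.symm p).1 (finSigmaFinEquiv.symm p).2)
        (fun p => d (finSigmaFinEquiv.symm p).1 (finSigmaFinEquiv.symm p).2) h₁ =
      act (comp b (fun j => comp (a j) (d j) (hda j)) h₂)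
        (finSigmaFinEquiv.symm.trans
          ((finSigmaFinEquiv.symm.sigmaCongrLeft
              (β := fun q : (Σ j, Fin (k j)) => Fin (l q.1 q.2))).trans
            ((Equiv.sigmaAssoc fun j i => Fin (l j i)).trans
              ((Equiv.sigmaCongrRight fun _ => finSigmaFinEquiv).trans finSigmaFinEquiv))))
  /-- equivariance of substitution in the outer operation -/
  act_comp : ∀ {m n : ℕ} (b : Op n) (σ : Fin m ≃ Fin n) {k : Fin n → ℕ} (a : ∀ j, Op (k j))
    (h : ∀ j, out (a j) = inp b j) (h' : ∀ j, out (a (σ j)) = inp (act b σ) j),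
    comp (act b σ) (k := fun j => k (σ j)) (fun j => a (σ j)) h' =
      act (comp b a h)
        (finSigmaFinEquiv.symm.trans
          ((σ.sigmaCongrLeft (β := fun j => Fin (k j))).trans finSigmaFinEquiv))
  /-- equivariance of substitution in the inner operations -/
  comp_act : ∀ {n : ℕ} (b : Op n) {k k' : Fin n → ℕ} (a : ∀ j, Op (k j))
    (τ : ∀ j, Fin (k' j) ≃ Fin (k j))
    (h : ∀ j, out (a j) = inp b j) (h' : ∀ j, out (act (a j) (τ j)) = inp b j),
    comp b (fun j => act (a j) (τ j)) h' =
      act (comp b a h)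
        (finSigmaFinEquiv.symm.trans ((Equiv.sigmaCongrRight τ).trans finSigmaFinEquiv))

/-! ### The symmetric monoidal category monad and finite sets -/

/-- Objects of the groupoid `𝔹` of finite sets and bijections (in its skeletal form:
the finite sets `{1, …, n}`). -/
structure FinBij where
  /-- the cardinality -/
  card : ℕ

/-- Morphisms in `𝔹` are bijections. -/
instance : Groupoid FinBij where
  Hom m n := Fin m.card ≃ Fin n.card
  id m := Equiv.refl _
  comp σ τ := Equiv.trans σ τ
  inv σ := Equiv.symm σ
  inv_comp σ := Equiv.symm_trans_self σ
  comp_inv σ := Equiv.self_trans_symm σ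

/-- Objects of `S X = ∫^{n ∈ 𝔹} Map(n, X)`: finite families of objects of `X`. -/
structure SymFam (X : Type u) where
  /-- the number of members of the family -/
  card : ℕ
  /-- the members of the family -/
  obj : Fin card → X

namespace SymFam

variable {X : Type*} [Category* X]

/-- A morphism of families is a bijection of index sets together with a family of morphisms. -/
@[ext]
structure Hom (x y : SymFam X) where
  /-- the bijection of index sets -/
  perm : Fin x.card ≃ Fin y.card
  /-- the morphisms between the members -/
  map : ∀ j, x.obj j ⟶ y.obj (perm j)

/-- The category `S X`. -/
instance : Category (SymFam X) where
  Hom := Hom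
  id x := ⟨Equiv.refl _, fun j => 𝟙 (x.obj j)⟩
  comp f g := ⟨f.perm.trans g.perm, fun j => f.map j ≫ g.map (f.perm j)⟩
  id_comp _ := Hom.ext rfl (heq_of_eq (funext fun _ => Category.id_comp _))
  comp_id _ := Hom.ext rfl (heq_of_eq (funext fun _ => Category.comp_id _))
  assoc _ _ _ := Hom.ext rfl (heq_of_eq (funext fun _ => Category.assoc _ _ _))

theorem Hom.map_eqToHom {x y : SymFam X} (f : x ⟶ y) {j k : Fin x.card} (h : j = k) :
    f.map j ≫ eqToHom (congrArg (fun i => y.obj (f.perm i)) h) =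
      eqToHom (congrArg x.obj h) ≫ f.map k := by
  subst h
  simp

theorem Hom.ext_of_eqToHom {x y : SymFam X} {f g : x ⟶ y} (h : ∀ j, f.perm j = g.perm j)
    (h' : ∀ j, f.map j ≫ eqToHom (congrArg y.obj (h j)) = g.map j) : f = g := by
  obtain ⟨σ, f⟩ := f
  obtain ⟨τ, g⟩ := g
  obtain rfl : σ = τ := Equiv.ext h
  obtain rfl : f = g := funext fun j => by simpa using h' j
  rfl

/-- If `X` is a groupoid then so is `S X`. -/
instance {X : Type*} [Groupoid X] : Groupoid (SymFam X) where
  inv {x y} f := (⟨f.perm.symm, fun j =>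
    eqToHom (congrArg y.obj (f.perm.apply_symm_apply j).symm) ≫
      Groupoid.inv (f.map (f.perm.symm j))⟩ : Hom y x)
  inv_comp {x y} f := by
    refine Hom.ext_of_eqToHom (fun j => f.perm.apply_symm_apply j) fun j => ?_
    change ((_ ≫ Groupoid.inv (f.map (f.perm.symm j))) ≫ f.map (f.perm.symm j)) ≫ _ = 𝟙 (y.obj j)
    simp
    exact eqToHom_trans _ _
  comp_inv {x y} f := by
    refine Hom.ext_of_eqToHom (fun j => f.perm.symm_apply_apply j) fun j => ?_
    change (f.map j ≫ eqToHom _ ≫ Groupoid.inv (f.map (f.perm.symm (f.perm j)))) ≫ eqToHom _ =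
      𝟙 (x.obj j)
    have h := Hom.map_eqToHom f (f.perm.symm_apply_apply j).symm
    rw [← Category.assoc (f.map j), h]
    simp
    exact eqToHom_trans _ _

/-- `S` on functors. -/
def mapFunctor {Y : Type*} [Category* Y] (F : X ⥤ Y) : SymFam X ⥤ SymFam Y where
  obj x := ⟨x.card, fun j => F.obj (x.obj j)⟩
  map f := ⟨f.perm, fun j => F.map (f.map j)⟩
  map_id _ := Hom.ext rfl (heq_of_eq (funext fun _ => F.map_id _))
  map_comp _ _ := Hom.ext rfl (heq_of_eq (funext fun _ => F.map_comp _ _))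

/-- The inclusion `Xⁿ ⥤ S X` of `n`-tuples into families. -/
def ofTuple (n : ℕ) : (Fin n → X) ⥤ SymFam X where
  obj x := ⟨n, x⟩
  map {x y} f := (⟨Equiv.refl (Fin n), f⟩ : Hom (SymFam.mk n x) (SymFam.mk n y))
  map_id _ := rfl
  map_comp _ _ := rfl

/-- The permutation of the entries of `n`-tuples by a bijection `σ`. -/
abbrev permute {m n : ℕ} (σ : Fin m ≃ Fin n) : (Fin m → X) ⥤ (Fin n → X) :=
  Pi.comap (fun _ : Fin m => X) fun j => σ.symm j

theorem entry_eqToHom {n : ℕ} {x y : Fin n → X} (f : x ⟶ y) {j k : Fin n} (h : j = k) :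
    f j ≫ eqToHom (congrArg y h) = eqToHom (congrArg x h) ≫ f k := by
  subst h
  simp

/-- A tuple and its permutation by `σ` are isomorphic as families, via `σ`. -/
def permuteHom {m n : ℕ} (σ : Fin m ≃ Fin n) :
    ofTuple (X := X) m ⟶ permute σ ⋙ ofTuple n where
  app x := (⟨σ, fun j => eqToHom (congrArg x (σ.symm_apply_apply j).symm)⟩ :
    Hom (SymFam.mk m x) (SymFam.mk n fun j => x (σ.symm j)))
  naturality x y f := by
    refine Hom.ext rfl (heq_of_eq (funext fun j => ?_))
    exact entry_eqToHom f (σ.symm_apply_apply j).symm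

theorem permuteHom_refl (n : ℕ) (x : Fin n → X) :
    (permuteHom (Equiv.refl (Fin n))).app x = 𝟙 ((ofTuple n).obj x) := rfl

theorem permuteHom_trans {l m n : ℕ} (σ : Fin l ≃ Fin m) (τ : Fin m ≃ Fin n) (x : Fin l → X) :
    (permuteHom (σ.trans τ)).app x =
      (permuteHom σ).app x ≫ (permuteHom τ).app ((permute σ).obj x) := by
  refine Hom.ext rfl (heq_of_eq (funext fun j => ?_))
  exact (eqToHom_trans (congrArg x (σ.symm_apply_apply j).symm)
    (congrArg (fun i => x (σ.symm i)) (τ.symm_apply_apply (σ j)).symm)).symm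

end SymFam

/-! ### Homotopy sums -/

section HomotopySum

variable {S : Type u₁} [Category.{v₁} S]

/-- The inclusion of the one-object groupoid `Aut s` into `S`. -/
def autIncl (s : S) : SingleObj (Aut s) ⥤ S where
  obj _ := s
  map g := Iso.hom g
  map_id _ := rfl
  map_comp _ _ := rfl

/-- The homotopy quotient (action groupoid) `X_s / Aut(s)` of the action of `Aut(s)` on the
category `X_s`: its objects are those of `X_s`, and an arrow `x ⟶ y` is a pair consisting of
`g ∈ Aut(s)` and an arrow `g • x ⟶ y` in `X_s`. -/
abbrev HomotopyQuotient (X : S ⥤ Cat) (s : S) :=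
  Grothendieck (autIncl s ⋙ X)

/-- The homotopy sum `∫^{s ∈ S} X_s = ∑_{s ∈ π₀ S} X_s / Aut(s)` of a family of categories (in
practice, groupoids) indexed by a groupoid `S`: one representative `s` is chosen in each
isomorphism class of objects of `S`. -/
abbrev HomotopySum (X : S ⥤ Cat) :=
  Σ c : Quotient (isIsomorphicSetoid S), HomotopyQuotient X (Quotient.out c)

/-- The canonical map from the homotopy sum to the total category of the family. -/
def HomotopySum.toTotal (X : S ⥤ Cat) : HomotopySum X ⥤ Grothendieck X :=
  Sigma.desc fun c => Grothendieck.pre X (autIncl (Quotient.out c))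

/-- A functor out of the homotopy sum, given by functors out of the members of the family that are
compatible with the action of `S`. -/
def HomotopySum.desc {X : S ⥤ Cat.{v₂, u₂}} {Z : Type u₃} [Category.{v₃} Z]
    (fib : ∀ s, X.obj s ⥤ Z)
    (hom : ∀ {s t : S} (f : s ⟶ t), fib s ⟶ (X.map f).toFunctor ⋙ fib t)
    (hom_id : ∀ (s : S) (x : X.obj s), (hom (𝟙 s)).app x =
      eqToHom (by rw [Functor.comp_obj, X.map_id]; rfl))
    (hom_comp : ∀ {s t u : S} (f : s ⟶ t) (g : t ⟶ u) (x : X.obj s), (hom (f ≫ g)).app x =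
      (hom f).app x ≫ (hom g).app ((X.map f).toFunctor.obj x) ≫
        eqToHom (by simp only [Functor.comp_obj, X.map_comp]; rfl)) :
    HomotopySum X ⥤ Z :=
  HomotopySum.toTotal X ⋙ Grothendieck.functorFrom fib hom
    (fun s => NatTrans.ext (funext fun x => by rw [hom_id, eqToHom_app]))
    (fun _ _ _ f g => NatTrans.ext (funext fun x => by
      rw [hom_comp, NatTrans.comp_app, NatTrans.comp_app, eqToHom_app, Functor.whiskerLeft_app]))

variable {X : Type u₂} {Y : Type u₃} [Category.{v₂} X] [Category.{v₃} Y]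

/-- The family `s ↦ X_s × Y_s`, where `X_s` and `Y_s` are the homotopy fibres over `s` of maps
of groupoids `p : X ⥤ S` and `q : Y ⥤ S`: the objects of `X_s` are pairs of `x : X` and an
arrow `p x ⟶ s`, and `S` acts by postcomposition. -/
def fibreProd (p : X ⥤ S) (q : Y ⥤ S) :
    S ⥤ Cat.{max v₂ v₃, max (max u₂ v₁) (max u₃ v₁)} where
  obj s := Cat.of (CostructuredArrow p s × CostructuredArrow q s)
  map f := Functor.toCatHom ((CostructuredArrow.map f).prod (CostructuredArrow.map f))
  map_id s := by
    have hp := congrArg Cat.Hom.toFunctor ((CostructuredArrow.functor p).map_id s)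
    have hq := congrArg Cat.Hom.toFunctor ((CostructuredArrow.functor q).map_id s)
    exact Cat.Hom.ext (congrArg₂ Functor.prod hp hq)
  map_comp f g := by
    have hp := congrArg Cat.Hom.toFunctor ((CostructuredArrow.functor p).map_comp f g)
    have hq := congrArg Cat.Hom.toFunctor ((CostructuredArrow.functor q).map_comp f g)
    exact Cat.Hom.ext (congrArg₂ Functor.prod hp hq)

/-- The projection of `∫^{s ∈ S} X_s × Y_s` to `X × Y`. -/
def fibreProdProj (p : X ⥤ S) (q : Y ⥤ S) : HomotopySum (fibreProd p q) ⥤ X × Y :=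
  HomotopySum.desc
    (fun s => ((CostructuredArrow.proj p s).prod (CostructuredArrow.proj q s) :
      CostructuredArrow p s × CostructuredArrow q s ⥤ X × Y))
    (fun {s _} _ =>
      { app := fun (x : CostructuredArrow p s × CostructuredArrow q s) => 𝟙 (x.1.left, x.2.left)
        naturality := fun _ _ _ => (Category.comp_id _).trans (Category.id_comp _).symm })
    (fun _ _ => rfl)
    (fun _ _ _ => ((Category.id_comp _).trans (Category.id_comp _)).symm)

end HomotopySum

/-- Two categories over `Z` are equivalent over `Z`, i.e. in the weak slice: there is an
equivalence commuting with the maps to `Z` up to natural isomorphism. -/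
def EquivalentOver {C D Z : Type*} [Category* C] [Category* D] [Category* Z]
    (p : C ⥤ Z) (q : D ⥤ Z) : Prop :=
  ∃ e : C ≌ D, Nonempty (e.functor ⋙ q ≅ p)

/-! ### The groupoids associated to an operad -/

namespace SymmetricOperad

variable {I : Type u} (R : SymmetricOperad.{u, v} I)

/-- Objects of the groupoid `B` of operations of `R`. -/
structure B where
  /-- the arity of the operation -/
  arity : ℕ
  /-- the operation -/
  op : R.Op arity

/-- The groupoid `B` of operations of `R`, the disjoint union of the action groupoids of the
symmetric group actions: an arrow `b ⟶ b'` is a bijection `σ` with `b = b'.σ`. -/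
instance : Groupoid R.B where
  Hom b b' := { σ : Fin b.arity ≃ Fin b'.arity // b.op = R.act b'.op σ }
  id b := ⟨Equiv.refl _, (R.act_refl b.op).symm⟩
  comp f g := ⟨f.1.trans g.1, f.2.trans ((congrArg (R.act · f.1) g.2).trans (R.act_act _ _ _))⟩
  inv f := ⟨f.1.symm, by
    refine ((congrArg (R.act · f.1.symm) f.2).trans ?_).symm
    simp only [R.act_act, Equiv.symm_trans_self, R.act_refl]⟩
  inv_comp f := Subtype.ext (Equiv.symm_trans_self f.1)
  comp_inv f := Subtype.ext (Equiv.self_trans_symm f.1)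

variable {R}

theorem B.inp_eq {b b' : R.B} (f : b ⟶ b') (j : Fin b.arity) :
    R.inp b.op j = R.inp b'.op (f.1 j) :=
  (congrArg (R.inp · j) f.2).trans (R.inp_act _ _ _)

theorem B.out_eq {b b' : R.B} (f : b ⟶ b') : R.out b.op = R.out b'.op :=
  (congrArg R.out f.2).trans (R.out_act _ _)

variable (R)

/-- The arity map `B ⥤ 𝔹`. -/
def arityFunctor : R.B ⥤ FinBij where
  obj b := ⟨b.arity⟩
  map f := f.1

/-- The map `t : B ⥤ I` assigning to an operation its output colour. -/
def outFunctor : R.B ⥤ Discrete I where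
  obj b := ⟨R.out b.op⟩
  map f := Discrete.eqToHom (B.out_eq f)

/-- The map `B ⥤ S I` assigning to an operation its sequence of input colours. -/
def inpFunctor : R.B ⥤ SymFam (Discrete I) where
  obj b := ⟨b.arity, fun j => ⟨R.inp b.op j⟩⟩
  map f := ⟨f.1, fun j => Discrete.eqToHom (B.inp_eq f j)⟩
  map_id _ := SymFam.Hom.ext rfl (heq_of_eq (funext fun _ => Subsingleton.elim _ _))
  map_comp _ _ := SymFam.Hom.ext rfl (heq_of_eq (funext fun _ => Subsingleton.elim _ _))

/-- The map `S t : S B ⥤ S I` assigning to a family of operations the family of their output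
colours. -/
def symOutFunctor : SymFam R.B ⥤ SymFam (Discrete I) :=
  SymFam.mapFunctor R.outFunctor

variable {X : Type*} [Category* X] (q : X ⥤ Discrete I)

/-- Objects of the value `R(X)` at `q : X ⥤ I` of the polynomial functor represented by
`I ← E → B → I`, where `E` is the groupoid of operations with a marked input slot: an operation
`b` together with a map over `I` from the fibre `E_b`, i.e. the set of input slots of `b`,
to `X`. -/
structure Labelled where
  /-- the operation -/
  base : R.B
  /-- the labels of the input slots -/
  label : Fin base.arity → X
  /-- the labels are compatible with the colours of the input slots -/
  colour_eq : ∀ j, (q.obj (label j)).as = R.inp base.op j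

namespace Labelled

variable {R q}

/-- Arrows in `R(X)`: an arrow of operations together with arrows between the labels. -/
@[ext]
structure Hom (x y : R.Labelled q) where
  /-- the arrow between the operations -/
  base : x.base ⟶ y.base
  /-- the arrows between the labels -/
  map : ∀ j, x.label j ⟶ y.label (base.1 j)

/-- The category `R(X)`. -/
instance : Category (R.Labelled q) where
  Hom := Hom
  id x := ⟨𝟙 x.base, fun j => 𝟙 (x.label j)⟩
  comp f g := ⟨f.base ≫ g.base, fun j => f.map j ≫ g.map (f.base.1 j)⟩
  id_comp _ := Hom.ext rfl (heq_of_eq (funext fun _ => Category.id_comp _))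
  comp_id _ := Hom.ext rfl (heq_of_eq (funext fun _ => Category.comp_id _))
  assoc _ _ _ := Hom.ext rfl (heq_of_eq (funext fun _ => Category.assoc _ _ _))

theorem Hom.map_eqToHom {x y : R.Labelled q} (f : x ⟶ y) {j k : Fin x.base.arity} (h : j = k) :
    f.map j ≫ eqToHom (congrArg (fun i => y.label (f.base.1 i)) h) =
      eqToHom (congrArg x.label h) ≫ f.map k := by
  subst h
  simp

theorem Hom.ext_of_eqToHom {x y : R.Labelled q} {f g : x ⟶ y}
    (h : ∀ j, f.base.1 j = g.base.1 j)
    (h' : ∀ j, f.map j ≫ eqToHom (congrArg y.label (h j)) = g.map j) : f = g := by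
  obtain ⟨⟨σ, hσ⟩, f⟩ := f
  obtain ⟨⟨τ, hτ⟩, g⟩ := g
  obtain rfl : σ = τ := Equiv.ext h
  obtain rfl : f = g := funext fun j => by simpa using h' j
  rfl

/-- If `X` is a groupoid then so is `R(X)`. -/
instance {X : Type*} [Groupoid X] {q : X ⥤ Discrete I} : Groupoid (R.Labelled q) where
  inv {x y} f := (⟨Groupoid.inv f.base, fun j =>
    eqToHom (congrArg y.label (f.base.1.apply_symm_apply j).symm) ≫
      Groupoid.inv (f.map (f.base.1.symm j))⟩ : Hom y x)
  inv_comp {x y} f := by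
    refine Hom.ext_of_eqToHom (fun j => f.base.1.apply_symm_apply j) fun j => ?_
    change ((_ ≫ Groupoid.inv (f.map (f.base.1.symm j))) ≫ f.map (f.base.1.symm j)) ≫ _ =
      𝟙 (y.label j)
    simp
    exact eqToHom_trans _ _
  comp_inv {x y} f := by
    refine Hom.ext_of_eqToHom (fun j => f.base.1.symm_apply_apply j) fun j => ?_
    change (f.map j ≫ eqToHom _ ≫ Groupoid.inv (f.map (f.base.1.symm (f.base.1 j)))) ≫
      eqToHom _ = 𝟙 (x.label j)
    have h := Hom.map_eqToHom f (f.base.1.symm_apply_apply j).symm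
    rw [← Category.assoc (f.map j), h]
    simp
    exact eqToHom_trans _ _

end Labelled

/-- The groupoid `C₂ = R(B ⥤ I)` of operations of `R` whose input slots are labelled by
operations of `R` of matching output colours. -/
abbrev C₂ := R.Labelled R.outFunctor

/-- The map `C₂ ⥤ S B` taking a labelled operation to the family of its labels. -/
def labelsFunctor : R.C₂ ⥤ SymFam R.B where
  obj x := ⟨x.base.arity, x.label⟩
  map f := ⟨f.base.1, f.map⟩

/-- The map `C₂ ⥤ B` taking a labelled operation to the underlying operation. -/
def baseFunctor : R.C₂ ⥤ R.B where
  obj x := x.base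
  map f := f.base

/-- The structure map `C₂ ⥤ S B × B`. -/
def C₂Proj : R.C₂ ⥤ SymFam R.B × R.B :=
  R.labelsFunctor.prod' R.baseFunctor

/-- The family `w ↦ B^w × {}_w B` indexed by `S I`, where `B^w` is the homotopy fibre over `w`
of `S t : S B ⥤ S I`, the groupoid of families of operations with output colours matched by a
bijection with `w`, and `{}_w B` is the homotopy fibre over `w` of `B ⥤ S I`, the groupoid of
operations with input colours matched by a bijection with `w`. -/
abbrev matchingFamily : SymFam (Discrete I) ⥤ Cat :=
  fibreProd R.symOutFunctor R.inpFunctor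

/-- The family `n ↦ B^n × {}_n B` indexed by `𝔹`, where `B^n` is the groupoid of `n`-tuples of
operations, on which bijections act by permuting the entries, and `{}_n B` is the homotopy fibre
over `n` of the arity map `B ⥤ 𝔹`. -/
def powerFamily : FinBij ⥤ Cat.{0, v} where
  obj n := Cat.of ((Fin n.card → R.B) × CostructuredArrow R.arityFunctor n)
  map σ := ((SymFam.permute (X := R.B) σ).prod (CostructuredArrow.map σ)).toCatHom
  map_id n := by
    have hq := congrArg Cat.Hom.toFunctor ((CostructuredArrow.functor R.arityFunctor).map_id n)
    exact Cat.Hom.ext (congrArg (Functor.prod (𝟭 (Fin n.card → R.B))) hq)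
  map_comp {l m n} σ τ := by
    have hq := congrArg Cat.Hom.toFunctor
      ((CostructuredArrow.functor R.arityFunctor).map_comp σ τ)
    exact Cat.Hom.ext (congrArg (Functor.prod (SymFam.permute (X := R.B) (σ ≫ τ))) hq)

/-- The projection of `∫^{n ∈ 𝔹} B^n × {}_n B` to `S B × B`. -/
def powerFamilyProj : HomotopySum R.powerFamily ⥤ SymFam R.B × R.B :=
  HomotopySum.desc
    (fun n => ((SymFam.ofTuple n.card).prod (CostructuredArrow.proj R.arityFunctor n) :
      (Fin n.card → R.B) × CostructuredArrow R.arityFunctor n ⥤ SymFam R.B × R.B))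
    (fun {m _} σ =>
      { app := fun (x : (Fin m.card → R.B) × CostructuredArrow R.arityFunctor m) =>
          ((SymFam.permuteHom σ).app x.1, 𝟙 x.2.left)
        naturality := fun _ _ f => Prod.ext ((SymFam.permuteHom σ).naturality f.1)
          ((Category.comp_id _).trans (Category.id_comp _).symm) })
    (fun _ _ => rfl)
    (fun σ τ x => by
      refine Eq.trans ?_ (congrArg _ (Category.comp_id _)).symm
      exact Prod.ext (SymFam.permuteHom_trans σ τ x.1) (Category.id_comp _).symm)

end SymmetricOperad

end

-- Summing a product of homotopy fibres over its base gives a homotopy fibre product: the right-hand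
-- side consists of a family of operations, an operation, and arrows in `S I` from the output
-- colours and from the input colours to a common `w`. Contracting `w` leaves one arrow from output
-- colours to input colours. Reindexing the family makes its bijection the identity, and since `I`
-- is discrete what remains is exactly the colour condition of `C₂`.
--
-- By `toTotal_isEquivalence` the homotopy sum may be replaced by the Grothendieck construction.
-- Both sides are then faithful over `S B × B`, so `EquivalentOver.of_faithful` reduces the claim to
-- objects and to images of arrows: on either side these are the pairs of an arrow of families and
-- an arrow of operations with the same permutation. With one colour the condition is void, and
-- tuples over `𝔹` replace the fibres over `S I`.

universe w₁ w₂ w₃ w₄ w₅ w₆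

/-! ### Equivalences over a base -/

/-- A category `C` faithful over `Z` is equivalent over `Z` to a category `D` faithful over `Z` as
soon as a map on objects over `Z` is essentially surjective and identifies the images in `Z` of
the sets of morphisms. -/
theorem EquivalentOver.of_faithful {C : Type w₁} {D : Type w₂} {Z : Type w₃}
    [Category.{w₄} C] [Category.{w₅} D] [Category.{w₆} Z] (Q : C ⥤ Z) (P : D ⥤ Z)
    [Q.Faithful] [P.Faithful] (o : C → D) (i : ∀ c, P.obj (o c) ≅ Q.obj c)
    (lift : ∀ {c c' : C} (f : c ⟶ c'), ∃ g : o c ⟶ o c',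
      P.map g = (i c).hom ≫ Q.map f ≫ (i c').inv)
    (full : ∀ {c c' : C} (g : o c ⟶ o c'), ∃ f : c ⟶ c',
      P.map g = (i c).hom ≫ Q.map f ≫ (i c').inv)
    (surj : ∀ d, ∃ c, Nonempty (o c ≅ d)) : EquivalentOver Q P := by
  -- Lifts are unique because `P` is faithful, so an arbitrary choice is automatically functorial.
  choose g hg using @lift
  let F : C ⥤ D :=
    { obj := o
      map := g
      map_id := fun c => P.map_injective (by simp [hg])
      map_comp := fun f f' => P.map_injective (by simp [hg]) }
  have : F.Faithful := ⟨fun {c c'} f f' h => Q.map_injective (by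
    have h' : P.map (g f) = P.map (g f') := congrArg P.map h
    simpa [hg] using h')⟩
  have : F.Full := ⟨fun {c c'} k => by
    obtain ⟨f, hf⟩ := full k
    exact ⟨f, P.map_injective ((hg f).trans hf.symm)⟩⟩
  have : F.EssSurj := ⟨surj⟩
  have : F.IsEquivalence := { }
  exact ⟨F.asEquivalence, ⟨NatIso.ofComponents i fun f => by
    change P.map (g f) ≫ (i _).hom = (i _).hom ≫ Q.map f
    simp [hg]⟩⟩

/-! ### The homotopy sum as a total category -/

namespace HomotopySum

variable {S : Type w₁} [Groupoid.{w₂} S] (X : S ⥤ Cat.{w₃, w₄})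

instance toTotal_faithful : (toTotal X).Faithful where
  map_injective := by
    rintro ⟨c, x⟩ ⟨_, y⟩ ⟨f⟩ ⟨g⟩ h
    obtain ⟨f, f'⟩ := f
    obtain ⟨g, g'⟩ := g
    have hb : f = g := Iso.ext (congrArg Grothendieck.Hom.base h)
    subst hb
    obtain rfl : f' = g' := (Grothendieck.congr h).trans (Category.id_comp _)
    rfl

instance toTotal_full : (toTotal X).Full where
  map_surjective := by
    rintro ⟨c, x⟩ ⟨d, y⟩ ⟨f, f'⟩
    have e := (Groupoid.isoEquivHom (Quotient.out c) (Quotient.out d)).symm f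
    -- Arrows of the groupoid `S` are invertible, so two chosen representatives joined by an arrow
    -- represent the same class.
    obtain rfl : c = d := Quotient.out_equiv_out.1 ⟨e⟩
    exact ⟨.mk ⟨(Groupoid.isoEquivHom (Quotient.out c) (Quotient.out c)).symm f, f'⟩, rfl⟩

instance toTotal_essSurj : (toTotal X).EssSurj where
  mem_essImage x := by
    obtain ⟨e⟩ := Quotient.exact (Quotient.out_eq (Quotient.mk (isIsomorphicSetoid S) x.base))
    -- The fibre component is transported along an isomorphism from the base of `x` to its chosen
    -- representative.
    exact ⟨⟨Quotient.mk _ x.base, ⟨SingleObj.star _, (X.map e.inv).toFunctor.obj x.fiber⟩⟩,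
      ⟨x.transportIso e.symm⟩⟩

instance toTotal_isEquivalence : (toTotal X).IsEquivalence where

end HomotopySum

theorem EquivalentOver.homotopySum {S : Type w₁} [Groupoid.{w₂} S] {X : S ⥤ Cat.{w₃, w₄}}
    {C : Type w₅} {Z : Type w₆} [Category* C] [Category* Z] {Q : C ⥤ Z} {P : Grothendieck X ⥤ Z}
    (h : EquivalentOver Q P) : EquivalentOver Q (HomotopySum.toTotal X ⋙ P) := by
  obtain ⟨e, ⟨i⟩⟩ := h
  let t := (HomotopySum.toTotal X).asEquivalence
  exact ⟨e.trans t.symm, ⟨Functor.isoWhiskerLeft e.functor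
    (Functor.isoWhiskerRight t.counitIso P) ≪≫ i⟩⟩

/-! ### Families of objects of a discrete category -/

theorem SymFam.hom_ext_of_discrete {I : Type w₁} {x y : SymFam (Discrete I)} {f g : x ⟶ y}
    (h : f.perm = g.perm) : f = g :=
  SymFam.Hom.ext_of_eqToHom (fun j => congrArg (· j) h) fun _ => Subsingleton.elim _ _

/-! ### Labelled operations and faithfulness over the base -/

namespace SymmetricOperad

variable {I : Type w₁} (R : SymmetricOperad.{w₁, w₂} I)

instance C₂Proj_faithful : R.C₂Proj.Faithful where
  map_injective {x y f g} h := by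
    have h₁ : (⟨f.base.1, f.map⟩ : SymFam.Hom (R.labelsFunctor.obj x) (R.labelsFunctor.obj y)) =
      ⟨g.base.1, g.map⟩ := congrArg Prod.fst h
    obtain ⟨⟨σ, hσ⟩, f⟩ := f
    obtain ⟨⟨τ, hτ⟩, g⟩ := g
    obtain ⟨rfl, h₂⟩ := SymFam.Hom.mk.inj h₁
    obtain rfl := eq_of_heq h₂
    rfl

/-- The matching of a labelled operation: the input colours of the operation are the output
colours of the labels. -/
def matching (x : R.C₂) : R.symOutFunctor.obj (R.labelsFunctor.obj x) ⟶
    R.inpFunctor.obj x.base :=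
  (⟨Equiv.refl _, fun j => Discrete.eqToHom (x.colour_eq j)⟩ :
    SymFam.Hom (R.symOutFunctor.obj (R.labelsFunctor.obj x)) (R.inpFunctor.obj x.base))

end SymmetricOperad

/-- The structure arrow `a.hom` is invertible, so the triangle in the first factor recovers the base
arrow from its underlying arrow in `X`. This makes the projection to `X × Y` faithful. -/
theorem fibreProd_hom_ext {S : Type w₁} [Groupoid.{w₂} S] {X : Type w₃} {Y : Type w₄}
    [Category.{w₅} X] [Category.{w₆} Y] (p : X ⥤ S) (q : Y ⥤ S)
    {x y : Grothendieck (fibreProd p q)} (f g : x ⟶ y)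
    (h₁ : f.fiber.1.left = g.fiber.1.left) (h₂ : f.fiber.2.left = g.fiber.2.left) : f = g := by
  obtain ⟨s, ⟨a, b⟩⟩ := x
  obtain ⟨t, ⟨c, d⟩⟩ := y
  obtain ⟨f, f₁, f₂⟩ := f
  obtain ⟨g, g₁, g₂⟩ := g
  have hf : p.map f₁.left ≫ c.hom = a.hom ≫ f := CostructuredArrow.w f₁
  have hg : p.map g₁.left ≫ c.hom = a.hom ≫ g := CostructuredArrow.w g₁
  change f₁.left = g₁.left at h₁
  change f₂.left = g₂.left at h₂
  obtain rfl : f = g := by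
    rw [h₁] at hf
    exact (cancel_epi a.hom).1 (hf.symm.trans hg)
  obtain rfl : f₁ = g₁ := CostructuredArrow.hom_ext _ _ h₁
  obtain rfl : f₂ = g₂ := CostructuredArrow.hom_ext _ _ h₂
  rfl

/-! ### The many-coloured equivalence -/

namespace SymmetricOperad

variable {I : Type w₁} (R : SymmetricOperad.{w₁, w₂} I)

/-- A labelled operation as a matching of a family of operations with an operation. -/
def toMatching (x : R.C₂) : Grothendieck R.matchingFamily :=
  ⟨R.inpFunctor.obj x.base,
    (CostructuredArrow.mk (Y := R.labelsFunctor.obj x) (R.matching x),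
      CostructuredArrow.mk (Y := x.base) (𝟙 (R.inpFunctor.obj x.base)))⟩

theorem equivalentOver_matchingFamily :
    EquivalentOver R.C₂Proj (fibreProdProj R.symOutFunctor R.inpFunctor) := by
  refine EquivalentOver.homotopySum ?_
  refine @EquivalentOver.of_faithful _ _ _ _ _ _ _ _ _ ⟨fun {x y f g} h => ?_⟩ R.toMatching
    (fun _ => Iso.refl _) (fun {c c'} f => ?_) (fun {c c'} g => ?_) (fun d => ?_)
  · have h₁ := congrArg Prod.fst h
    have h₂ := congrArg Prod.snd h
    exact fibreProd_hom_ext _ _ f g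
      (((Category.id_comp _).symm.trans h₁).trans (Category.id_comp _))
      (((Category.id_comp _).symm.trans h₂).trans (Category.id_comp _))
  · refine ⟨⟨R.inpFunctor.map f.base,
      (CostructuredArrow.homMk (R.labelsFunctor.map f) (SymFam.hom_ext_of_discrete rfl),
        CostructuredArrow.homMk f.base
          ((Category.comp_id _).trans (Category.id_comp _).symm))⟩, ?_⟩
    refine (Category.id_comp _).trans ?_
    simp
    rfl
  · obtain ⟨w, g₁, g₂⟩ := g
    -- The structure arrows of `toMatching` have identity permutations, so the two triangles equate
    -- the permutation of the labels and that of the operation with the permutation of `w`.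
    have h₁ := congrArg SymFam.Hom.perm (CostructuredArrow.w g₁)
    have h₂ := congrArg SymFam.Hom.perm (CostructuredArrow.w g₂)
    have h : g₁.left.perm = g₂.left.1 := h₁.trans h₂.symm
    refine ⟨(⟨⟨g₁.left.perm, ?_⟩, g₁.left.map⟩ : Labelled.Hom c c'), ?_⟩
    · rw [h]
      exact g₂.left.2
    · refine (Category.id_comp _).trans ?_
      simp only [Iso.refl_hom, Iso.refl_inv]
      refine Eq.trans ?_ ((Category.id_comp _).trans (Category.comp_id _)).symm
      exact Prod.ext rfl (Subtype.ext h.symm)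
  · obtain ⟨s, a, b⟩ := d
    let α : Fin a.left.card ≃ Fin s.card := a.hom.perm
    let β : Fin b.left.arity ≃ Fin s.card := b.hom.perm
    -- The bijections `α` and `β` to the index set of `s` match slot `j` of the operation with the
    -- member `α⁻¹(β j)` of the family; both have the colour of `s` at `β j`.
    let c : R.C₂ := ⟨b.left, fun j => a.left.obj (α.symm (β j)), fun j =>
      (Discrete.eq_of_hom (a.hom.map (α.symm (β j)))).trans
        ((congrArg (fun k => (s.obj k).as) (α.apply_symm_apply (β j))).trans
          (Discrete.eq_of_hom (b.hom.map j)).symm)⟩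
    let l : R.labelsFunctor.obj c ⟶ a.left :=
      (⟨β.trans α.symm, fun j => 𝟙 _⟩ : SymFam.Hom (R.labelsFunctor.obj c) a.left)
    refine ⟨c, ⟨Grothendieck.isoMk ((Groupoid.isoEquivHom _ _).symm b.hom) (Iso.prod
      (CostructuredArrow.isoMk ((Groupoid.isoEquivHom _ _).symm l) ?_)
      (CostructuredArrow.isoMk (Iso.refl _) ?_))⟩⟩
    · exact SymFam.hom_ext_of_discrete (Equiv.ext fun j => α.apply_symm_apply (β j))
    · exact SymFam.hom_ext_of_discrete rfl

/-! ### The one-coloured equivalence -/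

/-- A labelled operation as a tuple of operations and an operation of matching arity. -/
def toPower (x : R.C₂) : Grothendieck R.powerFamily :=
  ⟨R.arityFunctor.obj x.base,
    (x.label, CostructuredArrow.mk (Y := x.base) (𝟙 (R.arityFunctor.obj x.base)))⟩

theorem equivalentOver_powerFamily [Subsingleton I] :
    EquivalentOver R.C₂Proj R.powerFamilyProj := by
  refine EquivalentOver.homotopySum ?_
  refine @EquivalentOver.of_faithful _ _ _ _ _ _ _ _ _ ⟨fun {x y f g} h => ?_⟩ R.toPower
    (fun _ => Iso.refl _) (fun {c c'} f => ?_) (fun {c c'} g => ?_) (fun d => ?_)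
  · obtain ⟨s, x, b⟩ := x
    obtain ⟨t, y, d⟩ := y
    obtain ⟨(σ : Fin s.card ≃ Fin t.card), f₁, f₂⟩ := f
    obtain ⟨(τ : Fin s.card ≃ Fin t.card), g₁, g₂⟩ := g
    obtain ⟨hb, hm⟩ := SymFam.Hom.mk.inj (congrArg Prod.fst h)
    obtain rfl : σ = τ := hb
    have h₂ : f₂.left = g₂.left :=
      ((Category.id_comp _).symm.trans (congrArg Prod.snd h)).trans (Category.id_comp _)
    obtain rfl : f₂ = g₂ := CostructuredArrow.hom_ext _ _ h₂
    obtain rfl : f₁ = g₁ := by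
      -- The image of the arrow in `S B` has entry `f₁ (σ j)` at `j`, preceded by an invertible
      -- transport; as `σ` is surjective, every entry of `f₁` is recovered.
      funext i
      obtain ⟨j, rfl⟩ := σ.surjective i
      exact (cancel_epi (eqToHom (congrArg x (σ.symm_apply_apply j).symm))).1
        (congrFun (eq_of_heq hm) j)
    rfl
  · let σ : Fin c.base.arity ≃ Fin c'.base.arity := f.base.1
    -- The fibre arrow starts at the permuted tuple, whose entry at `i` is the label of slot `σ⁻¹
    -- i`.
    refine ⟨⟨σ, (fun i => f.map (σ.symm i) ≫
        eqToHom (congrArg c'.label (σ.apply_symm_apply i)),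
      CostructuredArrow.homMk f.base
        ((Category.comp_id _).trans (Category.id_comp _).symm))⟩, ?_⟩
    simp only [Iso.refl_hom, Iso.refl_inv]
    refine Eq.trans ?_ ((Category.id_comp _).trans (Category.comp_id _)).symm
    refine Prod.ext (SymFam.Hom.ext rfl (heq_of_eq (funext fun j => ?_))) (Category.id_comp _)
    change eqToHom (congrArg c.label (σ.symm_apply_apply j).symm) ≫ f.map (σ.symm (σ j)) ≫
      eqToHom (congrArg c'.label (σ.apply_symm_apply (σ j))) = f.map j
    have h := Labelled.Hom.map_eqToHom f (σ.symm_apply_apply j).symm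
    rw [← Category.assoc]
    refine (congrArg (· ≫ _) h.symm).trans ?_
    simp
  · obtain ⟨σ, m, k⟩ := g
    have h : k.left.1 = σ := CostructuredArrow.w k
    -- The arrows between labels are read off from the image of the arrow in `S B`: the permutation
    -- isomorphism followed by `m`.
    refine ⟨(⟨⟨σ, h ▸ k.left.2⟩, fun j => ((SymFam.permuteHom σ).app c.label ≫
      (SymFam.ofTuple _).map m).map j⟩ : Labelled.Hom c c'), ?_⟩
    simp only [Iso.refl_hom, Iso.refl_inv]
    refine Eq.trans ?_ ((Category.id_comp _).trans (Category.comp_id _)).symm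
    exact Prod.ext rfl ((Category.id_comp _).trans (Subtype.ext h))
  · obtain ⟨n, x, b⟩ := d
    let β : Fin b.left.arity ≃ Fin n.card := b.hom
    -- Reindexing the tuple along `β` and then permuting it by `β` returns `x` itself, so the
    -- isomorphism of tuples is a transport.
    refine ⟨⟨b.left, fun j => x (β j), fun _ => Subsingleton.elim _ _⟩,
      ⟨Grothendieck.isoMk ((Groupoid.isoEquivHom _ _).symm b.hom) (Iso.prod
        (eqToIso (funext fun i => congrArg x (β.apply_symm_apply i)))
        (CostructuredArrow.isoMk (Iso.refl _) ?_))⟩⟩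
    exact Equiv.ext fun _ => rfl

end SymmetricOperad

theorem mainTheorem5 {I : Type u} (R : SymmetricOperad.{u, v} I) :
    EquivalentOver R.C₂Proj (fibreProdProj R.symOutFunctor R.inpFunctor) ∧
      (Nonempty (Unique I) → EquivalentOver R.C₂Proj R.powerFamilyProj) := by
  refine ⟨R.equivalentOver_matchingFamily, fun ⟨_⟩ => ?_⟩
  exact R.equivalentOver_powerFamily
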